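/- Let $n,p$ be integers with $1<p<n$. For a symmetric real $n\times n$ matrix $A$ with eigenvalues $\lambda_1,\dots,\lambda_n$ (counted with multiplicity) put $$\mathcal M_p(A)=\prod_{1\le i_1<\dots<i_p\le n}(\lambda_{i_1}+\dots+\lambda_{i_p}),$$ and let $P_p$ be the cone of those symmetric $A$ for which $\lambda_{i_1}+\dots+\lambda_{i_p}>0$ for all $1\le i_1<\dots<i_p\le n$. A $C^2$ function $u:\mathbb R^n\to\mathbb R$ is called $p$-plurisubharmonic if $D^2u(x)\in\overline{P_p}$ for every $x\in\mathbb R^n$ (closure in the space of symmetric matrices), and $\mathcal M_p(u)(x):=\mathcal M_p(D^2u(x))$. **Corollary.** Let $u\in C^3(\mathbb R^n)$ be a $p$-plurisubharmonic solution of $\mathcal M_p(u)=0$ on all of $\mathbb R^n$. If $u$ is bounded, or more generally if $u(x)=o(|x|)$ as $|x|\to\infty$, then $u$ is constant. -/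

import Mathlib

open Asymptotics

noncomputable section

namespace PPsh

variable {n : ℕ}

/-- The Hessian matrix `D²u(x)`, with entries the second partial derivatives of `u` at `x`. -/
def hessian (u : EuclideanSpace ℝ (Fin n) → ℝ) (x : EuclideanSpace ℝ (Fin n)) :
    Matrix (Fin n) (Fin n) ℝ :=
  Matrix.of fun i j =>
    fderiv ℝ (fderiv ℝ u) x (EuclideanSpace.single i 1) (EuclideanSpace.single j 1)

theorem hessian_isHermitian {u : EuclideanSpace ℝ (Fin n) → ℝ} (hu : ContDiff ℝ 2 u)
    (x : EuclideanSpace ℝ (Fin n)) : (hessian u x).IsHermitian := by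
  have h : IsSymmSndFDerivAt ℝ u x := hu.contDiffAt.isSymmSndFDerivAt (by simp)
  ext i j
  simpa [hessian] using h.eq _ _

/-- The cone `P_p` of symmetric matrices all of whose sums of `p` eigenvalues are positive.
Eigenvalues are counted with multiplicity and indexed by `Fin n`; the `p`-element sets of indices
stand for the increasing `p`-tuples `i₁ < ⋯ < i_p`. -/
def pConvexCone (n p : ℕ) : Set (Matrix (Fin n) (Fin n) ℝ) :=
  {A | ∃ hA : A.IsHermitian,
    ∀ I ∈ (Finset.univ : Finset (Fin n)).powersetCard p, 0 < ∑ i ∈ I, hA.eigenvalues i}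

/-- `u` is a `p`-plurisubharmonic function on `ℝⁿ`: it is `C²` and its Hessian lies everywhere in
the closure of `P_p`. (The symmetric matrices are closed in the space of all matrices, so the
closure can be taken there.) -/
def IsPPlurisubharmonic (p : ℕ) (u : EuclideanSpace ℝ (Fin n) → ℝ) : Prop :=
  ContDiff ℝ 2 u ∧ ∀ x, hessian u x ∈ closure (pConvexCone n p)

/-- The operator `M_p(u)(x) = ∏_{i₁ < ⋯ < i_p} (λ_{i₁} + ⋯ + λ_{i_p})` for a `C²` function `u`,
with `λ_i` the eigenvalues of `D²u(x)`. -/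
def pMongeAmpere (p : ℕ) (u : EuclideanSpace ℝ (Fin n) → ℝ) (hu : ContDiff ℝ 2 u)
    (x : EuclideanSpace ℝ (Fin n)) : ℝ :=
  ∏ I ∈ (Finset.univ : Finset (Fin n)).powersetCard p,
    ∑ i ∈ I, (hessian_isHermitian hu x).eigenvalues i

end PPsh

end

/-!
At every point `x` some `p` eigenvalues of `D²u(x)` sum to zero. By Ky Fan's principle the partial
trace of `D²u` over the corresponding eigenvectors, kept fixed, is nonnegative everywhere, so it is
minimal at `x` and its gradient vanishes there. This replaces the differentiated equation, which is
not available because eigenvalues need not depend smoothly on the point.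

Bernstein's method then applies to `η² |∇u|² + K u²`, where `η` is a cutoff on a ball of radius `R`.
At an interior maximum the second-order conditions, summed over the degenerate directions, control
the components of `∇u` along them. The remaining components are controlled by the first-order
condition alone, since the remaining eigenvalues are nonnegative: if one of them were negative, the
sum over the degenerate directions could be lowered by exchanging it in. The outcome is
`|∇u| ≤ C_p M / R` at the center of a ball of radius `R` on which `|u| ≤ M`, and `M = o(R)` for a
function of sublinear growth.
-/

open Filter Topology Bornology Metric
open scoped RealInnerProductSpace Matrix Gradient

namespace PPsh

section SecondOrderCalculus

theorem deriv_deriv_nonpos_of_isLocalMax {g : ℝ → ℝ} {a : ℝ} (hg : ContinuousAt g a)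
    (hmax : IsLocalMax g a) : deriv (deriv g) a ≤ 0 := by
  by_contra! hpos
  have hmin : IsLocalMin g a := isLocalMin_of_deriv_deriv_pos hpos hmax.deriv_eq_zero hg
  have hconst : g =ᶠ[𝓝 a] fun _ => g a := by
    filter_upwards [hmax, hmin] with t hle hge using le_antisymm hle hge
  have hderiv : deriv g =ᶠ[𝓝 a] fun _ => 0 := by
    filter_upwards [hconst.eventuallyEq_nhds] with t ht
    rw [ht.deriv_eq, deriv_const]
  rw [hderiv.deriv_eq, deriv_const] at hpos
  exact hpos.false

variable {E : Type*} [NormedAddCommGroup E] [NormedSpace ℝ E] {f g : E → ℝ} {x : E}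

theorem differentiable_fderiv_of_contDiff_two {F : Type*} [NormedAddCommGroup F] [NormedSpace ℝ F]
    {f : E → F} (hf : ContDiff ℝ 2 f) : Differentiable ℝ (fderiv ℝ f) :=
  (hf.fderiv_right (m := 1) (by norm_num)).differentiable (by norm_num)

theorem hasDerivAt_comp_line {F : Type*} [NormedAddCommGroup F] [NormedSpace ℝ F] {f : E → F}
    (hf : Differentiable ℝ f) (x e : E) (t : ℝ) :
    HasDerivAt (fun t : ℝ => f (x + t • e)) (fderiv ℝ f (x + t • e) e) t := by
  have hline : HasDerivAt (fun t : ℝ => x + t • e) e t := by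
    simpa using ((hasDerivAt_id t).smul_const e).const_add x
  exact (hf (x + t • e)).hasFDerivAt.comp_hasDerivAt t hline

theorem fderiv_fderiv_nonpos_of_isLocalMax (hf : ContDiff ℝ 2 f) (hmax : IsLocalMax f x) (e : E) :
    fderiv ℝ (fderiv ℝ f) x e e ≤ 0 := by
  have hline : Tendsto (fun t : ℝ => x + t • e) (𝓝 0) (𝓝 x) :=
    Continuous.tendsto' (by fun_prop) _ _ (by simp)
  have hmax_line : IsLocalMax (fun t : ℝ => f (x + t • e)) 0 := by
    filter_upwards [hline.eventually hmax] with t ht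
    simpa using ht
  have hderiv : deriv (fun t : ℝ => f (x + t • e)) = fun t => fderiv ℝ f (x + t • e) e :=
    funext fun t => (hasDerivAt_comp_line (hf.differentiable (by norm_num)) x e t).deriv
  have hderiv₂ : HasDerivAt (fun t : ℝ => fderiv ℝ f (x + t • e) e)
      (fderiv ℝ (fderiv ℝ f) x e e) 0 := by
    simpa using (hasDerivAt_comp_line (differentiable_fderiv_of_contDiff_two hf) x e 0).clm_apply
      (hasDerivAt_const (0 : ℝ) e)
  rw [← hderiv₂.deriv, ← hderiv]
  exact deriv_deriv_nonpos_of_isLocalMax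
    (hf.continuous.comp (by fun_prop : Continuous fun t : ℝ => x + t • e)).continuousAt hmax_line

theorem fderiv_fderiv_mul_apply (hf : ContDiff ℝ 2 f) (hg : ContDiff ℝ 2 g) (x v w : E) :
    fderiv ℝ (fderiv ℝ fun z => f z * g z) x v w =
      f x * fderiv ℝ (fderiv ℝ g) x v w + fderiv ℝ f x v * fderiv ℝ g x w +
        (g x * fderiv ℝ (fderiv ℝ f) x v w + fderiv ℝ g x v * fderiv ℝ f x w) := by
  have hf₁ : Differentiable ℝ f := hf.differentiable (by norm_num)
  have hg₁ : Differentiable ℝ g := hg.differentiable (by norm_num)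
  have hf₂ := differentiable_fderiv_of_contDiff_two hf
  have hg₂ := differentiable_fderiv_of_contDiff_two hg
  have hmul : (fderiv ℝ fun z => f z * g z) = fun z => f z • fderiv ℝ g z + g z • fderiv ℝ f z :=
    funext fun z => fderiv_fun_mul (hf₁ z) (hg₁ z)
  rw [hmul, fderiv_fun_add ((hf₁ x).fun_smul (hg₂ x)) ((hg₁ x).fun_smul (hf₂ x)),
    fderiv_fun_smul (hf₁ x) (hg₂ x), fderiv_fun_smul (hg₁ x) (hf₂ x)]
  simp

theorem first_order_condition_of_isLocalMax_sq_add_mul_sq {κ : ℝ} (hf : DifferentiableAt ℝ f x)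
    (hg : DifferentiableAt ℝ g x) (hmax : IsLocalMax (fun z => f z ^ 2 + κ * g z ^ 2) x) (e : E) :
    f x * fderiv ℝ f x e + κ * (g x * fderiv ℝ g x e) = 0 := by
  have h := DFunLike.congr_fun (hmax.hasFDerivAt_eq_zero
    ((hf.hasFDerivAt.pow 2).add ((hg.hasFDerivAt.pow 2).const_mul κ))) e
  simp only [Nat.add_one_sub_one, pow_one, nsmul_eq_mul, Nat.cast_ofNat, add_apply, smul_apply,
    smul_eq_mul, zero_apply] at h
  linarith

theorem second_order_condition_of_isLocalMax_sq_add_mul_sq {κ : ℝ} (hf : ContDiff ℝ 2 f)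
    (hg : ContDiff ℝ 2 g) (hmax : IsLocalMax (fun z => f z ^ 2 + κ * g z ^ 2) x) (e : E) :
    fderiv ℝ f x e ^ 2 + f x * fderiv ℝ (fderiv ℝ f) x e e +
      κ * (fderiv ℝ g x e ^ 2 + g x * fderiv ℝ (fderiv ℝ g) x e e) ≤ 0 := by
  have hff : ContDiff ℝ 2 fun z => f z * f z := hf.mul hf
  have hgg : ContDiff ℝ 2 fun z => g z * g z := hg.mul hg
  simp only [pow_two (f _), pow_two (g _)] at hmax
  have hderiv : (fderiv ℝ fun z => f z * f z + κ * (g z * g z)) =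
      fun z => fderiv ℝ (fun z => f z * f z) z + κ • fderiv ℝ (fun z => g z * g z) z := by
    funext z
    have hff₁ := hff.differentiable (by norm_num) z
    have hgg₁ := hgg.differentiable (by norm_num) z
    rw [fderiv_fun_add hff₁ (hgg₁.const_mul κ), fderiv_const_mul hgg₁]
  have h := fderiv_fderiv_nonpos_of_isLocalMax (hff.add (contDiff_const.mul hgg)) hmax e
  have hff₂ := differentiable_fderiv_of_contDiff_two hff x
  have hgg₂ := differentiable_fderiv_of_contDiff_two hgg x
  rw [hderiv, fderiv_fun_add hff₂ (hgg₂.fun_const_smul κ), fderiv_fun_const_smul hgg₂,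
    add_apply, add_apply, smul_apply, smul_apply, fderiv_fderiv_mul_apply hf hf,
    fderiv_fderiv_mul_apply hg hg, smul_eq_mul] at h
  linarith

end SecondOrderCalculus

section DirectionalDerivatives

variable {E : Type*} [NormedAddCommGroup E] [NormedSpace ℝ E] {u : E → ℝ}

theorem fderiv_fderiv_apply_const {F : Type*} [NormedAddCommGroup F] [NormedSpace ℝ F] {f : E → F}
    (hf : ContDiff ℝ 2 f) (v x w : E) :
    fderiv ℝ (fun z => fderiv ℝ f z v) x w = fderiv ℝ (fderiv ℝ f) x w v := by
  simp [fderiv_clm_apply (differentiable_fderiv_of_contDiff_two hf x)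
    (differentiableAt_const v)]

theorem contDiff_two_fderiv_apply_const (hu : ContDiff ℝ 3 u) (v : E) :
    ContDiff ℝ 2 fun z => fderiv ℝ u z v :=
  (hu.fderiv_right (by norm_num)).clm_apply contDiff_const

theorem fderiv_fderiv_symm (hu : ContDiff ℝ 2 u) (x v w : E) :
    fderiv ℝ (fderiv ℝ u) x v w = fderiv ℝ (fderiv ℝ u) x w v :=
  (hu.contDiffAt.isSymmSndFDerivAt (by simp)).eq v w

theorem fderiv_fderiv_fderiv_apply_comm (hu : ContDiff ℝ 3 u) (v x e : E) :
    fderiv ℝ (fderiv ℝ fun z => fderiv ℝ u z v) x e e =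
      fderiv ℝ (fun z => fderiv ℝ (fderiv ℝ u) z e e) x v := by
  have hu₂ : ContDiff ℝ 2 u := hu.of_le (by norm_num)
  calc fderiv ℝ (fderiv ℝ fun z => fderiv ℝ u z v) x e e
      = fderiv ℝ (fun z => fderiv ℝ (fun y => fderiv ℝ u y v) z e) x e :=
        (fderiv_fderiv_apply_const (contDiff_two_fderiv_apply_const hu v) e x e).symm
    _ = fderiv ℝ (fun z => fderiv ℝ (fun y => fderiv ℝ u y e) z v) x e := by
        simp_rw [fderiv_fderiv_apply_const hu₂, fderiv_fderiv_symm hu₂ _ e v]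
    _ = fderiv ℝ (fderiv ℝ fun y => fderiv ℝ u y e) x v e := by
        rw [fderiv_fderiv_apply_const (contDiff_two_fderiv_apply_const hu e),
          fderiv_fderiv_symm (contDiff_two_fderiv_apply_const hu e)]
    _ = fderiv ℝ (fun z => fderiv ℝ (fderiv ℝ u) z e e) x v := by
        rw [← fderiv_fderiv_apply_const (contDiff_two_fderiv_apply_const hu e)]
        simp_rw [fderiv_fderiv_apply_const hu₂]

end DirectionalDerivatives

section DegenerateFrame

variable {ι E : Type*} [Fintype ι] [NormedAddCommGroup E] [InnerProductSpace ℝ E]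
  {u : E → ℝ} {x : E} {b : OrthonormalBasis ι ℝ E} {l : ι → ℝ} {I : Finset ι}

/-- `b` is an orthonormal eigenbasis of the Hessian of `u` at `x`, with eigenvalues `l`, exhibiting
the degeneracy of `u` in the directions `I`: the partial trace of the Hessian over `I` is
nonnegative everywhere and vanishes at `x`, and the eigenvalues at `x` off `I` are nonnegative. -/
structure IsDegenerateFrame (u : E → ℝ) (x : E) (b : OrthonormalBasis ι ℝ E) (l : ι → ℝ)
    (I : Finset ι) : Prop where
  fderiv_fderiv_apply : ∀ i v, fderiv ℝ (fderiv ℝ u) x (b i) v = l i * ⟪b i, v⟫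
  sum_eq_zero : ∑ i ∈ I, l i = 0
  nonneg_of_notMem : ∀ i ∉ I, 0 ≤ l i
  sum_fderiv_fderiv_nonneg : ∀ y, 0 ≤ ∑ i ∈ I, fderiv ℝ (fderiv ℝ u) y (b i) (b i)

theorem IsDegenerateFrame.add_const (h : IsDegenerateFrame u x b l I) (c : ℝ) :
    IsDegenerateFrame (fun z => u z + c) x b l I := by
  have hderiv : (fderiv ℝ fun z => u z + c) = fderiv ℝ u := funext fun _ => fderiv_add_const c
  exact ⟨by simpa only [hderiv] using h.fderiv_fderiv_apply, h.sum_eq_zero, h.nonneg_of_notMem,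
    by simpa only [hderiv] using h.sum_fderiv_fderiv_nonneg⟩

theorem IsDegenerateFrame.fderiv_fderiv_self (h : IsDegenerateFrame u x b l I) (i : ι) :
    fderiv ℝ (fderiv ℝ u) x (b i) (b i) = l i := by
  simp [h.fderiv_fderiv_apply]

/-- The partial trace of the Hessian over `I` has a minimum at `x`. -/
theorem IsDegenerateFrame.sum_fderiv_fderiv_fderiv_eq_zero (h : IsDegenerateFrame u x b l I)
    (hu : ContDiff ℝ 3 u) (v : E) :
    ∑ i ∈ I, fderiv ℝ (fderiv ℝ fun z => fderiv ℝ u z v) x (b i) (b i) = 0 := by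
  have hdiff : ∀ i ∈ I, DifferentiableAt ℝ (fun z => fderiv ℝ (fderiv ℝ u) z (b i) (b i)) x :=
    fun i _ => ((differentiable_fderiv_of_contDiff_two (hu.fderiv_right (by norm_num)) x).clm_apply
      (differentiableAt_const _)).clm_apply (differentiableAt_const _)
  have hmin : IsLocalMin (fun z => ∑ i ∈ I, fderiv ℝ (fderiv ℝ u) z (b i) (b i)) x :=
    Eventually.of_forall fun z => by
      simpa [h.fderiv_fderiv_self, h.sum_eq_zero] using h.sum_fderiv_fderiv_nonneg z
  simp_rw [fderiv_fderiv_fderiv_apply_comm hu]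
  rw [← sum_apply, ← fderiv_fun_sum hdiff, hmin.fderiv_eq_zero, zero_apply]

end DegenerateFrame

section GradientEstimate

section Cutoff

variable {E : Type*} [SeminormedAddCommGroup E]

/-- The quadratic cutoff `R² - |z - y|²`, positive exactly on the ball of radius `R` about `y`. -/
def cutoff (y : E) (R : ℝ) (z : E) : ℝ := R ^ 2 - ‖z - y‖ ^ 2

theorem cutoff_le (y : E) (R : ℝ) (z : E) : cutoff y R z ≤ R ^ 2 :=
  sub_le_self _ (sq_nonneg _)

theorem cutoff_self (y : E) (R : ℝ) : cutoff y R y = R ^ 2 := by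
  simp [cutoff]

theorem cutoff_nonneg_iff {y z : E} {R : ℝ} (hR : 0 ≤ R) :
    0 ≤ cutoff y R z ↔ z ∈ closedBall y R := by
  rw [cutoff, sub_nonneg, mem_closedBall, dist_eq_norm, sq_le_sq₀ (norm_nonneg _) hR]

theorem cutoff_pos_iff {y z : E} {R : ℝ} (hR : 0 ≤ R) : 0 < cutoff y R z ↔ z ∈ ball y R := by
  rw [cutoff, sub_pos, mem_ball, dist_eq_norm, sq_lt_sq₀ (norm_nonneg _) hR]

end Cutoff

variable {ι E : Type*} [Fintype ι] [NormedAddCommGroup E] [InnerProductSpace ℝ E]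

theorem contDiff_cutoff (y : E) (R : ℝ) {k : WithTop ℕ∞} : ContDiff ℝ k (cutoff y R) :=
  contDiff_const.sub ((contDiff_id.sub contDiff_const).norm_sq ℝ)

theorem fderiv_cutoff_apply (y : E) (R : ℝ) (z e : E) :
    fderiv ℝ (cutoff y R) z e = -2 * ⟪z - y, e⟫ := by
  have h : HasFDerivAt (cutoff y R) _ z :=
    (((hasFDerivAt_id z).sub_const y).norm_sq).const_sub (R ^ 2)
  rw [h.fderiv]
  simp [inner_sub_left]

theorem fderiv_fderiv_cutoff_apply (y : E) (R : ℝ) (z v w : E) :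
    fderiv ℝ (fderiv ℝ (cutoff y R)) z v w = -2 * ⟪v, w⟫ := by
  rw [← fderiv_fderiv_apply_const (contDiff_cutoff y R)]
  simp_rw [fderiv_cutoff_apply]
  have h := (((hasFDerivAt_id z).sub_const y).inner ℝ (hasFDerivAt_const w z)).const_mul (-2)
  simpa using DFunLike.congr_fun h.fderiv v

theorem sum_sq_fderiv_cutoff_le (b : OrthonormalBasis ι ℝ E) {y z : E} {R : ℝ}
    (hz : 0 ≤ cutoff y R z) (J : Finset ι) :
    ∑ i ∈ J, fderiv ℝ (cutoff y R) z (b i) ^ 2 ≤ 4 * R ^ 2 := by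
  calc ∑ i ∈ J, fderiv ℝ (cutoff y R) z (b i) ^ 2
      ≤ ∑ i, fderiv ℝ (cutoff y R) z (b i) ^ 2 :=
        Finset.sum_le_univ_sum_of_nonneg fun _ => sq_nonneg _
    _ = 4 * ‖z - y‖ ^ 2 := by
        simp_rw [fderiv_cutoff_apply, mul_pow, ← Finset.mul_sum, b.sum_sq_inner_left]
        norm_num
    _ ≤ 4 * R ^ 2 := by
        rw [cutoff] at hz
        linarith

/-- Bernstein's auxiliary function `η² |∇u|² + K u²`, with `η` the quadratic cutoff. -/
noncomputable def bernsteinFunction (u : E → ℝ) (y : E) (R K : ℝ) (z : E) : ℝ :=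
  cutoff y R z ^ 2 * ‖fderiv ℝ u z‖ ^ 2 + K * u z ^ 2

variable [CompleteSpace E] {u : E → ℝ} {x y : E} {R K : ℝ}

theorem fderiv_gradient_self (u : E → ℝ) (x : E) : fderiv ℝ u x (∇ u x) = ‖∇ u x‖ ^ 2 := by
  rw [← inner_gradient_left, real_inner_self_eq_norm_sq]

theorem norm_fderiv_eq_norm_gradient (u : E → ℝ) (x : E) : ‖fderiv ℝ u x‖ = ‖∇ u x‖ := by
  rw [← toDual_gradient, LinearIsometryEquiv.norm_map]

/-- Replacing `∇u` by its component along the fixed vector `∇u(x)` lowers the auxiliary function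
except at `x`, so the maximum persists and only scalar functions have to be differentiated. -/
theorem isLocalMax_sq_add_mul_sq_of_bernsteinFunction
    (hmax : IsLocalMax (bernsteinFunction u y R K) x) :
    IsLocalMax (fun z => (cutoff y R z * fderiv ℝ u z (∇ u x)) ^ 2 +
      K * ‖∇ u x‖ ^ 2 * u z ^ 2) x := by
  filter_upwards [hmax] with z hz
  have hle : fderiv ℝ u z (∇ u x) ^ 2 ≤ ‖fderiv ℝ u z‖ ^ 2 * ‖∇ u x‖ ^ 2 := by
    rw [← mul_pow]
    exact sq_le_sq' (neg_le_of_abs_le ((fderiv ℝ u z).le_opNorm _))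
      (le_of_abs_le ((fderiv ℝ u z).le_opNorm _))
  calc (cutoff y R z * fderiv ℝ u z (∇ u x)) ^ 2 + K * ‖∇ u x‖ ^ 2 * u z ^ 2
      ≤ bernsteinFunction u y R K z * ‖∇ u x‖ ^ 2 := by
        rw [bernsteinFunction]
        nlinarith [mul_le_mul_of_nonneg_left hle (sq_nonneg (cutoff y R z))]
    _ ≤ bernsteinFunction u y R K x * ‖∇ u x‖ ^ 2 := by gcongr
    _ = (cutoff y R x * fderiv ℝ u x (∇ u x)) ^ 2 + K * ‖∇ u x‖ ^ 2 * u x ^ 2 := by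
        rw [bernsteinFunction, norm_fderiv_eq_norm_gradient, fderiv_gradient_self]
        ring

variable {b : OrthonormalBasis ι ℝ E} {l : ι → ℝ} {I : Finset ι}

namespace IsDegenerateFrame

theorem fderiv_fderiv_gradient (h : IsDegenerateFrame u x b l I) (i : ι) :
    fderiv ℝ (fderiv ℝ u) x (b i) (∇ u x) = l i * fderiv ℝ u x (b i) := by
  rw [h.fderiv_fderiv_apply, real_inner_comm, inner_gradient_left]

theorem fderiv_cutoff_mul_fderiv_gradient (h : IsDegenerateFrame u x b l I) (hu : ContDiff ℝ 2 u)
    (i : ι) :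
    fderiv ℝ (fun z => cutoff y R z * fderiv ℝ u z (∇ u x)) x (b i) =
      fderiv ℝ (cutoff y R) x (b i) * ‖∇ u x‖ ^ 2 +
        cutoff y R x * (l i * fderiv ℝ u x (b i)) := by
  have hη : DifferentiableAt ℝ (cutoff y R) x := (contDiff_cutoff y R).differentiable one_ne_zero x
  have hv : DifferentiableAt ℝ (fun z => fderiv ℝ u z (∇ u x)) x :=
    (differentiable_fderiv_of_contDiff_two hu x).clm_apply (differentiableAt_const _)
  rw [fderiv_fun_mul hη hv, add_apply, smul_apply, smul_apply,
    fderiv_fderiv_apply_const hu, h.fderiv_fderiv_gradient, fderiv_gradient_self,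
    smul_eq_mul, smul_eq_mul]
  ring

theorem bernstein_first_order (h : IsDegenerateFrame u x b l I) (hu : ContDiff ℝ 3 u)
    (hmax : IsLocalMax (bernsteinFunction u y R K) x) (hgrad : ∇ u x ≠ 0) (i : ι) :
    cutoff y R x * ‖∇ u x‖ ^ 2 * fderiv ℝ (cutoff y R) x (b i) +
      (cutoff y R x ^ 2 * l i + K * u x) * fderiv ℝ u x (b i) = 0 := by
  have hv : ContDiff ℝ 2 fun z => cutoff y R z * fderiv ℝ u z (∇ u x) :=
    (contDiff_cutoff y R).mul (contDiff_two_fderiv_apply_const hu _)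
  have hcrit := first_order_condition_of_isLocalMax_sq_add_mul_sq
    (hv.differentiable (by norm_num) x) (hu.differentiable (by norm_num) x)
    (isLocalMax_sq_add_mul_sq_of_bernsteinFunction hmax) (b i)
  rw [h.fderiv_cutoff_mul_fderiv_gradient (hu.of_le (by norm_num)), fderiv_gradient_self]
    at hcrit
  have hw : ‖∇ u x‖ ^ 2 ≠ 0 := by simpa using hgrad
  apply mul_left_cancel₀ hw
  linear_combination hcrit

theorem bernstein_second_order (h : IsDegenerateFrame u x b l I) (hu : ContDiff ℝ 3 u)
    (hmax : IsLocalMax (bernsteinFunction u y R K) x) (i : ι) :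
    (fderiv ℝ (cutoff y R) x (b i) * ‖∇ u x‖ ^ 2 +
        cutoff y R x * (l i * fderiv ℝ u x (b i))) ^ 2 +
      cutoff y R x * ‖∇ u x‖ ^ 2 *
        (cutoff y R x * fderiv ℝ (fderiv ℝ fun z => fderiv ℝ u z (∇ u x)) x (b i) (b i) +
          2 * fderiv ℝ (cutoff y R) x (b i) * (l i * fderiv ℝ u x (b i)) - 2 * ‖∇ u x‖ ^ 2) +
      K * ‖∇ u x‖ ^ 2 * (fderiv ℝ u x (b i) ^ 2 + u x * l i) ≤ 0 := by
  have hu₂ : ContDiff ℝ 2 u := hu.of_le (by norm_num)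
  have hv : ContDiff ℝ 2 fun z => fderiv ℝ u z (∇ u x) := contDiff_two_fderiv_apply_const hu _
  have hself : ⟪b i, b i⟫ = 1 := by simp
  have hsecond := second_order_condition_of_isLocalMax_sq_add_mul_sq
    ((contDiff_cutoff y R).mul hv) hu₂ (isLocalMax_sq_add_mul_sq_of_bernsteinFunction hmax) (b i)
  rw [h.fderiv_cutoff_mul_fderiv_gradient hu₂, fderiv_fderiv_mul_apply (contDiff_cutoff y R) hv,
    fderiv_fderiv_cutoff_apply, fderiv_fderiv_apply_const hu₂, h.fderiv_fderiv_gradient,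
    h.fderiv_fderiv_self, hself, fderiv_gradient_self] at hsecond
  linear_combination hsecond

/-- Off `I` the eigenvalues are nonnegative, so they only help the term `K u` in the first-order
condition. -/
theorem mul_sum_compl_sq_fderiv_le_of_isLocalMax [DecidableEq ι] (h : IsDegenerateFrame u x b l I)
    (hu : ContDiff ℝ 3 u) (hmax : IsLocalMax (bernsteinFunction u y R K) x) (hgrad : ∇ u x ≠ 0)
    (hcut : 0 ≤ cutoff y R x) (hKu : 0 ≤ K * u x) :
    (K * u x) ^ 2 * ∑ i ∈ Iᶜ, fderiv ℝ u x (b i) ^ 2 ≤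
      4 * R ^ 2 * (cutoff y R x * ‖∇ u x‖ ^ 2) ^ 2 := by
  calc (K * u x) ^ 2 * ∑ i ∈ Iᶜ, fderiv ℝ u x (b i) ^ 2
      = ∑ i ∈ Iᶜ, (K * u x) ^ 2 * fderiv ℝ u x (b i) ^ 2 := Finset.mul_sum _ _ _
    _ ≤ ∑ i ∈ Iᶜ, (cutoff y R x * ‖∇ u x‖ ^ 2) ^ 2 * fderiv ℝ (cutoff y R) x (b i) ^ 2 := by
        refine Finset.sum_le_sum fun i hi => ?_
        have hl : 0 ≤ cutoff y R x ^ 2 * l i :=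
          mul_nonneg (sq_nonneg _) (h.nonneg_of_notMem i (Finset.mem_compl.mp hi))
        have hfirst := h.bernstein_first_order hu hmax hgrad i
        calc (K * u x) ^ 2 * fderiv ℝ u x (b i) ^ 2
            ≤ (cutoff y R x ^ 2 * l i + K * u x) ^ 2 * fderiv ℝ u x (b i) ^ 2 := by
              gcongr
              exact le_add_of_nonneg_left hl
          _ = (cutoff y R x * ‖∇ u x‖ ^ 2) ^ 2 * fderiv ℝ (cutoff y R) x (b i) ^ 2 := by
              rw [← mul_pow, ← mul_pow, eq_neg_of_add_eq_zero_right hfirst, neg_sq]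
    _ ≤ (cutoff y R x * ‖∇ u x‖ ^ 2) ^ 2 * (4 * R ^ 2) := by
        rw [← Finset.mul_sum]
        gcongr
        exact sum_sq_fderiv_cutoff_le b hcut _
    _ = 4 * R ^ 2 * (cutoff y R x * ‖∇ u x‖ ^ 2) ^ 2 := mul_comm _ _

theorem mul_sum_sq_fderiv_le_of_isLocalMax (h : IsDegenerateFrame u x b l I) (hu : ContDiff ℝ 3 u)
    (hmax : IsLocalMax (bernsteinFunction u y R K) x) (hgrad : ∇ u x ≠ 0)
    (hcut : 0 ≤ cutoff y R x) :
    K * ∑ i ∈ I, fderiv ℝ u x (b i) ^ 2 ≤ (2 * I.card + 12) * R ^ 2 * ‖∇ u x‖ ^ 2 := by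
  set w := ‖∇ u x‖ ^ 2
  set η := cutoff y R x
  set q : ι → ℝ := fun i => fderiv ℝ (cutoff y R) x (b i)
  set a : ι → ℝ := fun i => fderiv ℝ u x (b i)
  set v : ι → ℝ := fun i => fderiv ℝ (fderiv ℝ fun z => fderiv ℝ u z (∇ u x)) x (b i) (b i)
  have hw : 0 < w := by positivity
  have hdir : ∀ i, K * w * a i ^ 2 ≤
      2 * η * w ^ 2 + 3 * w ^ 2 * q i ^ 2 - η ^ 2 * w * v i - K * w * u x * l i := fun i => by
    -- With `A = q i * w` and `B = η * l i * a i`, use `(A + B) ^ 2 + 2 * A * B ≥ -3 * A ^ 2`.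
    linarith [h.bernstein_second_order hu hmax i, sq_nonneg (2 * (q i * w) + η * (l i * a i))]
  refine le_of_mul_le_mul_left ?_ hw
  calc w * (K * ∑ i ∈ I, a i ^ 2) = ∑ i ∈ I, K * w * a i ^ 2 := by
        rw [← Finset.mul_sum]
        ring
    _ ≤ ∑ i ∈ I, (2 * η * w ^ 2 + 3 * w ^ 2 * q i ^ 2 - η ^ 2 * w * v i - K * w * u x * l i) :=
        Finset.sum_le_sum fun i _ => hdir i
    _ = w * ((2 * I.card * η + 3 * ∑ i ∈ I, q i ^ 2) * w) := by
        have hv : ∑ i ∈ I, v i = 0 := h.sum_fderiv_fderiv_fderiv_eq_zero hu _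
        simp only [Finset.sum_sub_distrib, Finset.sum_add_distrib, ← Finset.mul_sum, hv,
          h.sum_eq_zero, Finset.sum_const, nsmul_eq_mul]
        ring
    _ ≤ w * ((2 * I.card * R ^ 2 + 3 * (4 * R ^ 2)) * w) := by
        gcongr
        · exact cutoff_le y R x
        · exact sum_sq_fderiv_cutoff_le b hcut I
    _ = w * ((2 * I.card + 12) * R ^ 2 * w) := by ring

theorem le_of_isLocalMax_bernsteinFunction (h : IsDegenerateFrame u x b l I) (hu : ContDiff ℝ 3 u)
    (hmax : IsLocalMax (bernsteinFunction u y R K) x) (hgrad : ∇ u x ≠ 0)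
    (hcut : 0 ≤ cutoff y R x) (hK : 0 < K) (hux : 0 < u x) :
    K ≤ (2 * I.card + 12) * R ^ 2 +
      4 * R ^ 2 * (cutoff y R x ^ 2 * ‖fderiv ℝ u x‖ ^ 2) / (K * u x ^ 2) := by
  classical
  rw [norm_fderiv_eq_norm_gradient]
  set w := ‖∇ u x‖ ^ 2
  set a : ι → ℝ := fun i => fderiv ℝ u x (b i)
  have hw : 0 < w := by positivity
  have hsplit : ∑ i ∈ I, a i ^ 2 + ∑ i ∈ Iᶜ, a i ^ 2 = w := by
    rw [Finset.sum_add_sum_compl]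
    simpa only [a, w, ← inner_gradient_left] using b.sum_sq_inner_left (∇ u x)
  have hcompl : K * ∑ i ∈ Iᶜ, a i ^ 2 ≤
      4 * R ^ 2 * (cutoff y R x * w) ^ 2 / (K * u x ^ 2) := by
    rw [le_div_iff₀ (by positivity)]
    calc (K * ∑ i ∈ Iᶜ, a i ^ 2) * (K * u x ^ 2) = (K * u x) ^ 2 * ∑ i ∈ Iᶜ, a i ^ 2 := by ring
      _ ≤ 4 * R ^ 2 * (cutoff y R x * w) ^ 2 :=
        h.mul_sum_compl_sq_fderiv_le_of_isLocalMax hu hmax hgrad hcut (by positivity)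
  refine le_of_mul_le_mul_right ?_ hw
  calc K * w = K * ∑ i ∈ I, a i ^ 2 + K * ∑ i ∈ Iᶜ, a i ^ 2 := by rw [← mul_add, hsplit]
    _ ≤ (2 * I.card + 12) * R ^ 2 * w + 4 * R ^ 2 * (cutoff y R x * w) ^ 2 / (K * u x ^ 2) :=
      add_le_add (h.mul_sum_sq_fderiv_le_of_isLocalMax hu hmax hgrad hcut) hcompl
    _ = ((2 * I.card + 12) * R ^ 2 + 4 * R ^ 2 * (cutoff y R x ^ 2 * w) / (K * u x ^ 2)) * w := by
      ring

end IsDegenerateFrame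

end GradientEstimate

section SublinearGrowth

variable {E : Type*} [SeminormedAddCommGroup E] {u : E → ℝ}

theorem isLittleO_norm_cobounded_of_abs_le {C : ℝ} (hu : ∀ x, |u x| ≤ C) :
    u =o[cobounded E] fun x => ‖x‖ :=
  (IsBigO.of_bound (g := fun _ => (1 : ℝ)) C
    (Eventually.of_forall fun x => by simpa using hu x)).trans_isLittleO
    (isLittleO_const_left.mpr <| .inr <| by
      simpa [Function.comp_def] using tendsto_norm_cobounded_atTop)

theorem eventually_forall_mem_closedBall_abs_le [ProperSpace E] (hu : Continuous u)
    (ho : u =o[cobounded E] fun x => ‖x‖) (y : E) {ε : ℝ} (hε : 0 < ε) :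
    ∀ᶠ R in atTop, ∀ z ∈ closedBall y R, |u z| ≤ ε * R := by
  obtain ⟨r, -, hfar⟩ := (hasBasis_cobounded_compl_closedBall (0 : E)).eventually_iff.mp
    (ho.bound (half_pos hε))
  obtain ⟨C, hnear⟩ := (isCompact_closedBall (0 : E) r).exists_bound_of_continuousOn
    hu.continuousOn
  filter_upwards [eventually_ge_atTop (C / ε), eventually_ge_atTop ‖y‖] with R hRC hRy z hz
  by_cases hzr : z ∈ closedBall 0 r
  · exact (hnear z hzr).trans ((div_le_iff₀' hε).mp hRC)
  · calc |u z| ≤ ε / 2 * ‖z‖ := by simpa using hfar hzr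
      _ ≤ ε / 2 * (‖y‖ + R) := by
        gcongr
        exact norm_le_of_mem_closedBall hz
      _ ≤ ε * R := by linarith [mul_le_mul_of_nonneg_left hRy hε.le]

end SublinearGrowth

section Liouville

variable {ι E : Type*} [Fintype ι] [NormedAddCommGroup E] [InnerProductSpace ℝ E]
  {u : E → ℝ} {x y z : E} {R K M : ℝ} {p : ℕ}

/-- `u` has a degenerate frame with exactly `p` degenerate directions at every point. -/
def HasDegenerateFrames (ι : Type*) [Fintype ι] (p : ℕ) (u : E → ℝ) : Prop :=
  ∀ x, ∃ (b : OrthonormalBasis ι ℝ E) (l : ι → ℝ) (I : Finset ι),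
    I.card = p ∧ IsDegenerateFrame u x b l I

theorem HasDegenerateFrames.add_const (h : HasDegenerateFrames ι p u) (c : ℝ) :
    HasDegenerateFrames ι p fun z => u z + c := fun x =>
  let ⟨b, l, I, hI, hframe⟩ := h x
  ⟨b, l, I, hI, hframe.add_const c⟩

theorem continuous_sq_cutoff_mul_sq_norm_fderiv (hu : ContDiff ℝ 1 u) (y : E) (R : ℝ) :
    Continuous fun z => cutoff y R z ^ 2 * ‖fderiv ℝ u z‖ ^ 2 :=
  ((contDiff_cutoff y R (k := 0)).continuous.pow 2).mul
    ((hu.continuous_fderiv one_ne_zero).norm.pow 2)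

/-- Where `η |∇u|` vanishes, in particular on the boundary, the auxiliary function is at most
`9 K M²`. -/
theorem exists_isLocalMax_bernsteinFunction [FiniteDimensional ℝ E] (hu : ContDiff ℝ 1 u)
    (hR : 0 ≤ R) (hK : 0 ≤ K) (hM : 0 ≤ M) (hbound : ∀ z ∈ closedBall y R, u z ∈ Set.Icc M (3 * M))
    (hz : z ∈ closedBall y R) (hlarge : 8 * K * M ^ 2 < cutoff y R z ^ 2 * ‖fderiv ℝ u z‖ ^ 2) :
    ∃ x ∈ ball y R, IsLocalMax (bernsteinFunction u y R K) x ∧ ∇ u x ≠ 0 := by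
  have hcont : Continuous (bernsteinFunction u y R K) :=
    (continuous_sq_cutoff_mul_sq_norm_fderiv hu y R).add
      (continuous_const.mul (hu.continuous.pow 2))
  obtain ⟨x, hx, hmax⟩ := (isCompact_closedBall y R).exists_isMaxOn ⟨z, hz⟩ hcont.continuousOn
  have hxM : K * u x ^ 2 ≤ K * (3 * M) ^ 2 := by
    have := hbound x hx
    gcongr
    exacts [hM.trans this.1, this.2]
  have hzM : K * M ^ 2 ≤ K * u z ^ 2 := by
    gcongr
    exact (hbound z hz).1
  have hmaxz : bernsteinFunction u y R K z ≤ bernsteinFunction u y R K x := hmax hz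
  rw [bernsteinFunction, bernsteinFunction] at hmaxz
  have hne : cutoff y R x ^ 2 * ‖fderiv ℝ u x‖ ^ 2 ≠ 0 := fun hzero => by linarith
  have hx' : x ∈ ball y R := (cutoff_pos_iff hR).mp <|
    ((cutoff_nonneg_iff hR).mpr hx).lt_of_ne' fun h => hne (by simp [h])
  refine ⟨x, hx', hmax.isLocalMax (closedBall_mem_nhds_of_mem hx'), fun hgrad => hne ?_⟩
  simp [norm_fderiv_eq_norm_gradient, hgrad]

theorem HasDegenerateFrames.sq_cutoff_mul_sq_norm_fderiv_le [FiniteDimensional ℝ E]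
    (h : HasDegenerateFrames ι p u) (hu : ContDiff ℝ 3 u) (hR : 0 ≤ R) (hM : 0 < M)
    (hbound : ∀ z ∈ closedBall y R, u z ∈ Set.Icc M (3 * M)) (hx : x ∈ closedBall y R) :
    cutoff y R x ^ 2 * ‖fderiv ℝ u x‖ ^ 2 ≤ 32 * (p + 38) * R ^ 2 * M ^ 2 := by
  have hu₁ : ContDiff ℝ 1 u := hu.of_le (by norm_num)
  obtain ⟨z, hz, hmax⟩ := (isCompact_closedBall y R).exists_isMaxOn ⟨x, hx⟩
    (continuous_sq_cutoff_mul_sq_norm_fderiv hu₁ y R).continuousOn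
  set S := cutoff y R z ^ 2 * ‖fderiv ℝ u z‖ ^ 2
  refine (hmax hx).trans ?_
  change S ≤ _
  rcases (show 0 ≤ S by positivity).eq_or_lt with hS₀ | hS₀
  · rw [← hS₀]
    positivity
  -- Any `K` below `S / (8 M²)` forces the maximum into the interior.
  set K := S / (16 * M ^ 2) with hKdef
  have hSK : S = 16 * K * M ^ 2 := by
    rw [hKdef]
    field_simp
  have hK : 0 < K := by positivity
  obtain ⟨x₀, hx₀, hlocmax, hgrad⟩ := exists_isLocalMax_bernsteinFunction hu₁ hR hK.le hM.le hbound
    hz (by nlinarith)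
  have hx₀' : x₀ ∈ closedBall y R := ball_subset_closedBall hx₀
  have hux : M ≤ u x₀ := (hbound x₀ hx₀').1
  obtain ⟨b, l, I, hI, hframe⟩ := h x₀
  have hratio : cutoff y R x₀ ^ 2 * ‖fderiv ℝ u x₀‖ ^ 2 / (K * u x₀ ^ 2) ≤ 16 := by
    have hux₀ : 0 < u x₀ := hM.trans_le hux
    rw [div_le_iff₀ (by positivity)]
    calc cutoff y R x₀ ^ 2 * ‖fderiv ℝ u x₀‖ ^ 2 ≤ S := hmax hx₀'
      _ = 16 * (K * M ^ 2) := by rw [hSK, mul_assoc]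
      _ ≤ 16 * (K * u x₀ ^ 2) := by gcongr
  have hKle := hframe.le_of_isLocalMax_bernsteinFunction hu hlocmax hgrad
    ((cutoff_nonneg_iff hR).mpr hx₀') hK (hM.trans_le hux)
  rw [hI, mul_div_assoc] at hKle
  calc S = 16 * K * M ^ 2 := hSK
    _ ≤ 16 * ((2 * p + 12) * R ^ 2 + 4 * R ^ 2 * 16) * M ^ 2 := by
      gcongr
      exact hKle.trans (by gcongr)
    _ = 32 * (p + 38) * R ^ 2 * M ^ 2 := by ring

theorem HasDegenerateFrames.sq_norm_fderiv_le [FiniteDimensional ℝ E]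
    (h : HasDegenerateFrames ι p u) (hu : ContDiff ℝ 3 u) (hR : 0 < R) (hM : 0 < M)
    (hbound : ∀ z ∈ closedBall y R, |u z| ≤ M) :
    ‖fderiv ℝ u y‖ ^ 2 ≤ 32 * (p + 38) * (M / R) ^ 2 := by
  have hshift := (h.add_const (2 * M)).sq_cutoff_mul_sq_norm_fderiv_le
    (hu.add contDiff_const) hR.le hM (fun z hz => by
      have := abs_le.mp (hbound z hz)
      constructor <;> linarith) (mem_closedBall_self hR.le)
  rw [cutoff_self, fderiv_add_const] at hshift
  rw [div_pow, ← mul_div_assoc, le_div_iff₀ (by positivity)]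
  refine le_of_mul_le_mul_right ?_ (sq_pos_of_pos hR)
  linarith

theorem HasDegenerateFrames.eq_const_of_isLittleO [FiniteDimensional ℝ E]
    (h : HasDegenerateFrames ι p u) (hu : ContDiff ℝ 3 u)
    (ho : u =o[cobounded E] fun x => ‖x‖) : ∃ c, ∀ x, u x = c := by
  have hbound : ∀ y, ∀ ε > 0, ‖fderiv ℝ u y‖ ^ 2 ≤ 32 * (p + 38) * ε ^ 2 := fun y ε hε => by
    obtain ⟨R, hR, hle⟩ := ((eventually_gt_atTop 0).and
      (eventually_forall_mem_closedBall_abs_le hu.continuous ho y hε)).exists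
    simpa [hR.ne'] using h.sq_norm_fderiv_le hu hR (mul_pos hε hR) hle
  have hzero : ∀ y, fderiv ℝ u y = 0 := fun y => by
    have hlim : Tendsto (fun ε : ℝ => 32 * (p + 38) * ε ^ 2) (𝓝[>] 0) (𝓝 0) :=
      Continuous.tendsto' (by fun_prop) _ _ (by simp) |>.mono_left nhdsWithin_le_nhds
    have hle := ge_of_tendsto hlim (eventually_mem_nhdsWithin.mono fun ε hε => hbound y ε hε)
    exact norm_eq_zero.mp (pow_eq_zero_iff two_ne_zero |>.mp (le_antisymm hle (sq_nonneg _)))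
  exact ⟨u 0, fun x => is_const_of_fderiv_eq_zero (hu.differentiable (by norm_num)) hzero x 0⟩

end Liouville

section PartialTraces

theorem le_of_forall_card_eq_sum_le {ι : Type*} {l : ι → ℝ} {I : Finset ι}
    (hI : ∀ J : Finset ι, J.card = I.card → ∑ i ∈ I, l i ≤ ∑ i ∈ J, l i) {i j : ι}
    (hi : i ∈ I) (hj : j ∉ I) : l i ≤ l j := by
  classical
  have hj' : j ∉ I.erase i := fun h => hj (Finset.mem_of_mem_erase h)
  have hswap := hI (insert j (I.erase i)) (by
    rw [Finset.card_insert_of_notMem hj', Finset.card_erase_add_one hi])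
  rw [Finset.sum_insert hj', ← Finset.add_sum_erase _ _ hi] at hswap
  exact le_of_add_le_add_right hswap

/-- Over the polytope of such weights a linear functional is minimized at a vertex. -/
theorem exists_card_eq_sum_le_sum_mul {ι : Type*} [Fintype ι] {p : ℕ} (l : ι → ℝ) {s : ι → ℝ}
    (hs₀ : ∀ i, 0 ≤ s i) (hs₁ : ∀ i, s i ≤ 1) (hsum : ∑ i, s i = p) :
    ∃ J : Finset ι, J.card = p ∧ ∑ i ∈ J, l i ≤ ∑ i, l i * s i := by
  classical
  have hp : p ≤ (Finset.univ : Finset ι).card := by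
    have := Finset.sum_le_card_nsmul Finset.univ s 1 fun i _ => hs₁ i
    rwa [hsum, nsmul_one, Nat.cast_le] at this
  obtain ⟨J, hJ, hmin⟩ := Finset.exists_min_image _ (fun J => ∑ i ∈ J, l i)
    (Finset.powersetCard_nonempty.mpr hp)
  simp only [Finset.mem_powersetCard_univ] at hJ hmin
  refine ⟨J, hJ, ?_⟩
  rcases J.eq_empty_or_nonempty with rfl | hne
  · have hs : ∀ i, s i = 0 := by
      simpa [← hJ, Finset.sum_eq_zero_iff_of_nonneg fun i _ => hs₀ i] using hsum
    simp [hs]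
  obtain ⟨m, hm, hmax⟩ := Finset.exists_max_image J l hne
  have hle : ∀ i ∉ J, l m ≤ l i := fun i hi =>
    le_of_forall_card_eq_sum_le (fun K hK => hmin K (hK.trans hJ)) hm hi
  have hshift : ∑ i ∈ J, (l i - l m) ≤ ∑ i, (l i - l m) * s i := by
    rw [← Finset.sum_add_sum_compl J fun i => (l i - l m) * s i]
    refine (Finset.sum_le_sum fun i hi => ?_).trans (le_add_of_nonneg_right <|
      Finset.sum_nonneg fun i hi => mul_nonneg (sub_nonneg.mpr (hle i (by simpa using hi))) (hs₀ i))
    nlinarith [hmax i hi, hs₁ i]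
  simp only [sub_mul, Finset.sum_sub_distrib, ← Finset.mul_sum, hsum, Finset.sum_const, hJ,
    nsmul_eq_mul] at hshift
  linarith

variable {m : Type*} [Fintype m] [DecidableEq m] {A : Matrix m m ℝ}

theorem eigenvectorBasis_dotProduct_mulVec (hA : A.IsHermitian) (k : m) (v : EuclideanSpace ℝ m) :
    (hA.eigenvectorBasis k).ofLp ⬝ᵥ A *ᵥ v.ofLp =
      hA.eigenvalues k * ⟪hA.eigenvectorBasis k, v⟫ := by
  have hAt : Aᵀ = A := by simpa [Matrix.IsHermitian] using hA
  rw [Matrix.dotProduct_mulVec, ← Matrix.mulVec_transpose, hAt, hA.mulVec_eigenvectorBasis,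
    smul_dotProduct, smul_eq_mul, EuclideanSpace.inner_eq_star_dotProduct, star_trivial,
    dotProduct_comm]

theorem dotProduct_mulVec_eq_sum_eigenvalues (hA : A.IsHermitian) (v : EuclideanSpace ℝ m) :
    v.ofLp ⬝ᵥ A *ᵥ v.ofLp = ∑ k, hA.eigenvalues k * ⟪hA.eigenvectorBasis k, v⟫ ^ 2 := by
  have hinner : ∀ x : EuclideanSpace ℝ m,
      ⟪x, WithLp.toLp 2 (A *ᵥ v.ofLp)⟫ = x.ofLp ⬝ᵥ A *ᵥ v.ofLp := fun x => by
    rw [EuclideanSpace.inner_eq_star_dotProduct, star_trivial, dotProduct_comm]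
  calc v.ofLp ⬝ᵥ A *ᵥ v.ofLp = ⟪v, WithLp.toLp 2 (A *ᵥ v.ofLp)⟫ := (hinner v).symm
    _ = ∑ k, hA.eigenvalues k * ⟪hA.eigenvectorBasis k, v⟫ ^ 2 := by
      rw [← hA.eigenvectorBasis.sum_inner_mul_inner]
      refine Finset.sum_congr rfl fun k _ => ?_
      rw [hinner, eigenvectorBasis_dotProduct_mulVec, real_inner_comm]
      ring

/-- Ky Fan's minimum principle. -/
theorem exists_sum_eigenvalues_le_sum_dotProduct_mulVec (hA : A.IsHermitian)
    (b : OrthonormalBasis m ℝ (EuclideanSpace ℝ m)) (I : Finset m) :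
    ∃ J : Finset m, J.card = I.card ∧
      ∑ k ∈ J, hA.eigenvalues k ≤ ∑ i ∈ I, (b i).ofLp ⬝ᵥ A *ᵥ (b i).ofLp := by
  set e := hA.eigenvectorBasis
  have hweight : ∀ k, ∑ i ∈ I, ⟪e k, b i⟫ ^ 2 ≤ 1 := fun k => by
    calc ∑ i ∈ I, ⟪e k, b i⟫ ^ 2 ≤ ∑ i, ⟪e k, b i⟫ ^ 2 :=
          Finset.sum_le_univ_sum_of_nonneg fun _ => sq_nonneg _
      _ = 1 := by simp [b.sum_sq_inner_left]
  have hsum : ∑ k, ∑ i ∈ I, ⟪e k, b i⟫ ^ 2 = I.card := by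
    rw [Finset.sum_comm]
    simp [e.sum_sq_inner_right]
  have htrace : ∑ i ∈ I, (b i).ofLp ⬝ᵥ A *ᵥ (b i).ofLp =
      ∑ k, hA.eigenvalues k * ∑ i ∈ I, ⟪e k, b i⟫ ^ 2 := by
    simp_rw [dotProduct_mulVec_eq_sum_eigenvalues hA, Finset.mul_sum]
    exact Finset.sum_comm
  rw [htrace]
  exact exists_card_eq_sum_le_sum_mul _ (fun k => Finset.sum_nonneg fun i _ => sq_nonneg _)
    hweight hsum

theorem sum_dotProduct_mulVec_nonneg_of_mem_closure {n : ℕ} {A : Matrix (Fin n) (Fin n) ℝ}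
    {I : Finset (Fin n)} (hA : A ∈ closure (pConvexCone n I.card))
    (b : OrthonormalBasis (Fin n) ℝ (EuclideanSpace ℝ (Fin n))) :
    0 ≤ ∑ i ∈ I, (b i).ofLp ⬝ᵥ A *ᵥ (b i).ofLp := by
  have hclosed : IsClosed {B : Matrix (Fin n) (Fin n) ℝ |
      0 ≤ ∑ i ∈ I, (b i).ofLp ⬝ᵥ B *ᵥ (b i).ofLp} :=
    isClosed_le continuous_const (by fun_prop)
  refine closure_minimal ?_ hclosed hA
  rintro B ⟨hB, hpos⟩
  obtain ⟨J, hJ, hle⟩ := exists_sum_eigenvalues_le_sum_dotProduct_mulVec hB b I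
  exact (hpos J (Finset.mem_powersetCard_univ.mpr hJ)).le.trans hle

end PartialTraces

section PPlurisubharmonic

variable {n p : ℕ} {u : EuclideanSpace ℝ (Fin n) → ℝ}

theorem fderiv_fderiv_eq_dotProduct_hessian (u : EuclideanSpace ℝ (Fin n) → ℝ)
    (x v w : EuclideanSpace ℝ (Fin n)) :
    fderiv ℝ (fderiv ℝ u) x v w = v.ofLp ⬝ᵥ hessian u x *ᵥ w.ofLp := by
  have hbasis : ∀ z : EuclideanSpace ℝ (Fin n), z = ∑ i, z i • EuclideanSpace.single i 1 :=
    fun z => by simpa using ((EuclideanSpace.basisFun (Fin n) ℝ).sum_repr z).symm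
  conv_lhs => rw [hbasis v, hbasis w]
  simp only [map_sum, map_smul, sum_apply, smul_apply, smul_eq_mul, dotProduct, Matrix.mulVec,
    hessian, Matrix.of_apply, Finset.mul_sum]
  rw [Finset.sum_comm]
  exact Finset.sum_congr rfl fun i _ => Finset.sum_congr rfl fun j _ => by ring

theorem IsPPlurisubharmonic.sum_fderiv_fderiv_nonneg (hu : IsPPlurisubharmonic p u)
    (b : OrthonormalBasis (Fin n) ℝ (EuclideanSpace ℝ (Fin n))) {I : Finset (Fin n)}
    (hI : I.card = p) (y : EuclideanSpace ℝ (Fin n)) :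
    0 ≤ ∑ i ∈ I, fderiv ℝ (fderiv ℝ u) y (b i) (b i) := by
  simp_rw [fderiv_fderiv_eq_dotProduct_hessian]
  exact sum_dotProduct_mulVec_nonneg_of_mem_closure (hI ▸ hu.2 y) b

theorem IsPPlurisubharmonic.hasDegenerateFrames (hu : IsPPlurisubharmonic p u) (hp : 0 < p)
    (hsol : ∀ x, pMongeAmpere p u hu.1 x = 0) : HasDegenerateFrames (Fin n) p u := fun x => by
  have hA := hessian_isHermitian hu.1 x
  obtain ⟨I, hI, hI₀⟩ := Finset.prod_eq_zero_iff.mp (hsol x)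
  rw [Finset.mem_powersetCard_univ] at hI
  have heigen : ∀ i v, fderiv ℝ (fderiv ℝ u) x (hA.eigenvectorBasis i) v =
      hA.eigenvalues i * ⟪hA.eigenvectorBasis i, v⟫ := fun i v => by
    rw [fderiv_fderiv_eq_dotProduct_hessian, eigenvectorBasis_dotProduct_mulVec]
  have hmin : ∀ J : Finset (Fin n), J.card = I.card →
      ∑ i ∈ I, hA.eigenvalues i ≤ ∑ i ∈ J, hA.eigenvalues i := fun J hJ => by
    rw [hI₀]
    simpa [heigen] using hu.sum_fderiv_fderiv_nonneg hA.eigenvectorBasis (hJ.trans hI) x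
  refine ⟨hA.eigenvectorBasis, hA.eigenvalues, I, hI, heigen, hI₀, fun j hj => ?_,
    hu.sum_fderiv_fderiv_nonneg _ hI⟩
  by_contra! hneg
  have hsum_neg : ∑ i ∈ I, hA.eigenvalues i < 0 := Finset.sum_neg
    (fun i hi => (le_of_forall_card_eq_sum_le hmin hi hj).trans_lt hneg)
    (Finset.card_pos.mp (hI ▸ hp))
  exact hsum_neg.ne hI₀

end PPlurisubharmonic

end PPsh

theorem mainTheorem5_general (n p : ℕ) (hp : 0 < p)
    (u : EuclideanSpace ℝ (Fin n) → ℝ) (hu : ContDiff ℝ 3 u)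
    (hpsh : PPsh.IsPPlurisubharmonic p u)
    (hsol : ∀ x, PPsh.pMongeAmpere p u (hu.of_le (by norm_num)) x = 0)
    (hgrowth : u =o[Bornology.cobounded (EuclideanSpace ℝ (Fin n))] fun x => ‖x‖) :
    ∃ c : ℝ, ∀ x, u x = c :=
  (hpsh.hasDegenerateFrames hp hsol).eq_const_of_isLittleO hu hgrowth

theorem mainTheorem5 (n p : ℕ) (hp : 1 < p) (hpn : p < n)
    (u : EuclideanSpace ℝ (Fin n) → ℝ) (hu : ContDiff ℝ 3 u)
    (hpsh : PPsh.IsPPlurisubharmonic p u)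
    (hsol : ∀ x, PPsh.pMongeAmpere p u (hu.of_le (by norm_num)) x = 0)
    (hgrowth : (∃ C : ℝ, ∀ x, |u x| ≤ C) ∨
      u =o[Bornology.cobounded (EuclideanSpace ℝ (Fin n))] fun x => ‖x‖) :
    ∃ c : ℝ, ∀ x, u x = c :=
  mainTheorem5_general n p (by omega) u hu hpsh hsol
    (hgrowth.elim (fun ⟨_, hC⟩ => PPsh.isLittleO_norm_cobounded_of_abs_le hC) id)
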